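/- **Theorem (linear convergence of L2SGD+).** Let $n,m\ge 1$, $d\ge 0$, and for $1\le i\le n$, $1\le j\le m$ let $\tilde f_{i,j}:\mathbb R^d\to\mathbb R$ be convex and $\tilde L$-smooth (differentiable with $\tilde L$-Lipschitz gradient), $\tilde L>0$, such that each $f_i=\frac1m\sum_{j=1}^m\tilde f_{i,j}$ is $\mu$-strongly convex, $\mu>0$. Let $\lambda\ge 0$ and $0<p<1$. For $x=(x_1,\dots,x_n)\in(\mathbb R^d)^n$ put $\bar x=\frac1n\sum_i x_i$, $\|x\|^2=\sum_i\|x_i\|^2$ and $$F(x)=\frac1n\sum_{i=1}^n f_i(x_i)+\frac{\lambda}{2n}\sum_{i=1}^n\|x_i-\bar x\|^2 .$$ *The method L2SGD+* with stepsize $\alpha$: start from $x_1^0=\dots=x_n^0\in\mathbb R^d$ (arbitrary), $J_i^0=0\in\mathbb R^{d\times m}$, $\Psi_i^0=0\in\mathbb R^d$. In iteration $k=0,1,2,\dots$ toss a coin $\xi^k$ that shows $1$ with probability $p$ and $0$ with probability $1-p$. - If $\xi^k=0$, every device $i$ samples $j=j_i^k\in\{1,\dots,m\}$ uniformly and sets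 $x_i^{k+1}=x_i^k-\alpha g_i^k$ with $$g_i^k=\tfrac{1}{n(1-p)}\bigl(\nabla\tilde f_{i,j}(x_i^k)-(J_i^k)_{:,j}\bigr)+\tfrac{1}{nm}\sum_{l=1}^m (J_i^k)_{:,l}+\tfrac1n\Psi_i^k;$$ moreover $(J_i^{k+1})_{:,j}=\nabla\tilde f_{i,j}(x_i^k)$, $(J_i^{k+1})_{:,l}=(J_i^k)_{:,l}$ for $l\ne j$, and $\Psi_i^{k+1}=\Psi_i^k$. - If $\xi^k=1$, then for every $i$, $x_i^{k+1}=x_i^k-\alpha g_i^k$ with $$g_i^k=\tfrac{\lambda}{np}(x_i^k-\bar x^k)-\tfrac{p^{-1}-1}{n}\Psi_i^k+\tfrac1{nm}\sum_{l=1}^m (J_i^k)_{:,l};$$ moreover $\Psi_i^{k+1}=\lambda(x_i^k-\bar x^k)$ and $J_i^{k+1}=J_i^k$. All coin tosses and samples are mutually independent. Choose $$\alpha=n\,\min\Bigl\{\frac{1-p}{4\tilde L+\mu m},\ \frac{p}{4\lambda+\mu}\Bigr\}.$$ Then $F$ has a unique minimizer $x(\lambda)$, and with the Lyapunov function $$V^k=\|x^k-x(\lambda)\|^2+\alpha\Bigl(\frac{1}{2n(1-p)\tilde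 L}\sum_{i=1}^n\sum_{j=1}^m\bigl\|(J_i^k)_{:,j}-\nabla\tilde f_{i,j}(x_i(\lambda))\bigr\|^2+\frac{1}{2np\lambda}\sum_{i=1}^n\bigl\|\Psi_i^k-\lambda(x_i(\lambda)-\bar x(\lambda))\bigr\|^2\Bigr)$$ (the last sum is dropped if $\lambda=0$) the following hold. 1. (Linear convergence.) $0<1-\frac{\alpha\mu}{n}<1$, and $\mathbb E[V^k]\le\bigl(1-\frac{\alpha\mu}{n}\bigr)^kV^0$ for all $k\ge 0$. 2. (Iteration complexity.) For every $\varepsilon>0$ and every integer $k\ge0$ with $$k\ \ge\ \max\Bigl\{\frac{4\tilde L+\mu m}{(1-p)\mu},\ \frac{4\lambda+\mu}{p\mu}\Bigr\}\log\frac1\varepsilon ,$$ one has $\mathbb E[V^k]\le\varepsilon V^0$, and in particular $\mathbb E\|x^k-x(\lambda)\|^2\le\varepsilon V^0$. All expectations above are of integrable random variables. -/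

import Mathlib

open MeasureTheory ProbabilityTheory

noncomputable section

namespace L2SGDPlus

/-- The parameter space `ℝ^d` of a single model, with its Euclidean norm. -/
abbrev Model (d : ℕ) : Type := EuclideanSpace ℝ (Fin d)

/-- A collection of local models `x = (x_1, …, x_n)`. The Euclidean norm of `ℝ^{nd}` is always
written out as a sum over the devices (see `sqDist`); the sup norm of this type is never used. -/
abbrev Models (n d : ℕ) : Type := Fin n → Model d

variable {n m d : ℕ}

/-- `‖x - y‖² = ∑ i, ‖x_i - y_i‖²`, the squared Euclidean distance in `ℝ^{nd}`. -/
def sqDist (x y : Models n d) : ℝ := ∑ i, ‖x i - y i‖ ^ 2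

/-- The average `x̄ = (1/n) ∑ i, x_i` of the local models. -/
def average (x : Models n d) : Model d := (n : ℝ)⁻¹ • ∑ i, x i

/-- The local objective `f_i = (1/m) ∑ j, f_{i,j}` of device `i`. -/
def localObjective (f : Fin n → Fin m → Model d → ℝ) (i : Fin n) (z : Model d) : ℝ :=
  (m : ℝ)⁻¹ * ∑ j, f i j z

/-- The penalty `ψ(x) = (1/(2n)) ∑ i, ‖x_i - x̄‖²`. -/
def penalty (x : Models n d) : ℝ := (2 * (n : ℝ))⁻¹ * ∑ i, ‖x i - average x‖ ^ 2

/-- The objective `F(x) = (1/n) ∑ i, f_i(x_i) + lam * ψ(x)`. -/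
def objective (f : Fin n → Fin m → Model d → ℝ) (lam : ℝ) (x : Models n d) : ℝ :=
  (n : ℝ)⁻¹ * ∑ i, localObjective f i (x i) + lam * penalty x

/-- `g` is `L`-smooth: differentiable with `L`-Lipschitz gradient. -/
def IsSmooth (L : ℝ) (g : Model d → ℝ) : Prop :=
  Differentiable ℝ g ∧ ∀ y z, ‖gradient g y - gradient g z‖ ≤ L * ‖y - z‖

/-- The state of the method: local models `x_i`, gradient tables `J_i ∈ ℝ^{d × m}`
(`J i j` is the column `j` of `J_i`), and control variates `Ψ_i`. -/
structure State (n m d : ℕ) where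
  x : Models n d
  J : Fin n → Fin m → Model d
  Psi : Fin n → Model d

/-- All devices start at the same model `x0`, with zero control variates. -/
def initState (x0 : Model d) : State n m d where
  x := fun _ => x0
  J := fun _ _ => 0
  Psi := fun _ => 0

/-- The direction `g_i` of a local step, `s i` being the data point sampled by device `i`:
`(1/(n(1-p))) (∇f_{i,s i}(x_i) - (J_i)_{:,s i}) + (1/(nm)) J_i 𝟙 + (1/n) Ψ_i`. -/
def localDirection (f : Fin n → Fin m → Model d → ℝ) (p : ℝ) (s : Fin n → Fin m)
    (S : State n m d) (i : Fin n) : Model d :=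
  ((n : ℝ) * (1 - p))⁻¹ • (gradient (f i (s i)) (S.x i) - S.J i (s i))
    + ((n : ℝ) * m)⁻¹ • ∑ j, S.J i j + (n : ℝ)⁻¹ • S.Psi i

/-- The local step, taken when the coin shows `0`. -/
def localStep (f : Fin n → Fin m → Model d → ℝ) (p α : ℝ) (s : Fin n → Fin m)
    (S : State n m d) : State n m d where
  x := fun i => S.x i - α • localDirection f p s S i
  J := fun i => Function.update (S.J i) (s i) (gradient (f i (s i)) (S.x i))
  Psi := S.Psi

/-- The direction `g_i` of an aggregation step:
`(lam/(np)) (x_i - x̄) - ((p⁻¹ - 1)/n) Ψ_i + (1/(nm)) J_i 𝟙`. -/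
def aggregationDirection (lam p : ℝ) (S : State n m d) (i : Fin n) : Model d :=
  (lam / ((n : ℝ) * p)) • (S.x i - average S.x) - ((p⁻¹ - 1) / (n : ℝ)) • S.Psi i
    + ((n : ℝ) * m)⁻¹ • ∑ j, S.J i j

/-- The aggregation step, taken when the coin shows `1`. -/
def aggregationStep (lam p α : ℝ) (S : State n m d) : State n m d where
  x := fun i => S.x i - α • aggregationDirection lam p S i
  J := S.J
  Psi := fun i => lam • (S.x i - average S.x)

/-- One iteration of L2SGD+, given the outcome `coin` of the coin toss (`true` is `1`)
and the data points `s` sampled by the devices (which only a local step looks at). -/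
def step (f : Fin n → Fin m → Model d → ℝ) (lam p α : ℝ) (coin : Bool) (s : Fin n → Fin m)
    (S : State n m d) : State n m d :=
  if coin then aggregationStep lam p α S else localStep f p α s S

/-- The state of L2SGD+ before iteration `k`, for given sequences of coin tosses and samples. -/
def run (f : Fin n → Fin m → Model d → ℝ) (lam p α : ℝ) (x0 : Model d)
    (coin : ℕ → Bool) (s : ℕ → Fin n → Fin m) : ℕ → State n m d
  | 0 => initState x0
  | k + 1 => step f lam p α (coin k) (s k) (run f lam p α x0 coin s k)

/-- The randomness of L2SGD+: in iteration `k` the coin `ξ k` shows `1` (`true`) with probability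
`p`, and `s k i` is the data point sampled by device `i`, uniform on `{1, …, m}`. All these random
variables are mutually independent: the rounds are independent of each other, and within each
round the coin is independent of the samples, which are independent across the devices. -/
structure IsSampling {Ω : Type*} [MeasurableSpace Ω] (P : Measure Ω) (p : ℝ)
    (ξ : ℕ → Ω → Bool) (s : ℕ → Fin n → Ω → Fin m) : Prop where
  measurable_coin : ∀ k, Measurable (ξ k)
  measurable_sample : ∀ k i, Measurable (s k i)
  coin_law : ∀ k, P.real {ω | ξ k ω = true} = p
  sample_law : ∀ k i j, P.real {ω | s k i ω = j} = (m : ℝ)⁻¹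
  indep_rounds : iIndepFun (fun k ω => (ξ k ω, fun i => s k i ω)) P
  indep_coin : ∀ k, IndepFun (ξ k) (fun ω i => s k i ω) P
  indep_devices : ∀ k, iIndepFun (fun i => s k i) P

/-- The Lyapunov function, relative to a reference point `xs` (the minimizer of `F`):
`‖x - xs‖² + α ((1/(2n(1-p)L)) ∑ i j, ‖(J_i)_{:,j} - ∇f_{i,j}(xs_i)‖²
  + (1/(2np lam)) ∑ i, ‖Ψ_i - lam (xs_i - x̄s)‖²)`.
For `lam = 0` the convention `0⁻¹ = 0` drops the last term (all `Ψ_i` are then zero). -/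
def lyapunov (f : Fin n → Fin m → Model d → ℝ) (lam p α L : ℝ) (xs : Models n d)
    (S : State n m d) : ℝ :=
  sqDist S.x xs
    + α * ((2 * (n : ℝ) * (1 - p) * L)⁻¹ * ∑ i, ∑ j, ‖S.J i j - gradient (f i j) (xs i)‖ ^ 2
      + (2 * (n : ℝ) * p * lam)⁻¹ * ∑ i, ‖S.Psi i - lam • (xs i - average xs)‖ ^ 2)

end L2SGDPlus

end

/-!
The two kinds of step form one variance-reduced gradient step. Write `A_j`, `B` for the deviations
at `x` of `∇f_{i,j}(x_i)` and `lam (x_i - x̄)` from their values at the minimizer, and `H_j`, `Q` for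
those of the stored `(J_i)_{:,j}` and `Ψ_i`. Since these optimal values satisfy
`(1/m) ∑ j ∇f_{i,j} + lam (x_i - x̄) = 0` (`optimality_of_forall_le`), the direction of device `i`,
multiplied by `n`, is `U - Z + 𝔼 Z`, where `U` is `A_j / (1 - p)` or `B / p` and `Z` is
`H_j / (1 - p)` or `Q / p` according to the coin. Its mean is `n` times the `i`-th block of
the gradient of `F`, and its second moment is at most `2 𝔼 ‖U‖² + 2 𝔼 ‖Z‖²` (`sum_weight_norm_sub_smul_sq_le`).

The inner product of the gradient with `x - xs` is bounded below by half of strong monotonicity plus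
half of cocoercivity (`inner_mean_gradient_sub_ge`). The first half gives the factor `1 - α μ / n`,
the second pays for the terms in `A_j`. The terms in `B` are paid for by the quadratic penalty, once
they are summed over the devices (`sum_consensus_terms_nonpos`). The terms in `H_j` and `Q` are
absorbed since each table entry is refreshed with probability `(1 - p) / m` and each `Ψ_i` with
probability `p`; the two bounds on the stepsize are exactly what this requires. This is the
one-round contraction `sum_weight_lyapunov_step_le`.

The contraction only involves the joint law of the coin and of one device's sample, because the
Lyapunov function is a sum over devices. As the state before round `k` is a function of the earlier
rounds, which take finitely many values and are independent of round `k`, the contraction can be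
integrated (`IsSampling.integral_run_succ_le`) and iterated.
-/

open MeasureTheory ProbabilityTheory

namespace L2SGDPlus

/-! ### Smooth and strongly convex functions on a Hilbert space -/

section ConvexAnalysis

variable {E : Type*} [NormedAddCommGroup E] [InnerProductSpace ℝ E] [CompleteSpace E]

theorem hasDerivAt_comp_line {g : E → ℝ} (hg : Differentiable ℝ g) (x v : E) (t : ℝ) :
    HasDerivAt (fun t : ℝ => g (x + t • v)) (inner ℝ (gradient g (x + t • v)) v) t := by
  have h1 : HasDerivAt (fun t : ℝ => x + t • v) v t := by
    simpa using ((hasDerivAt_id t).smul_const v).const_add x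
  have h2 := (hg (x + t • v)).hasGradientAt.hasFDerivAt.comp_hasDerivAt t h1
  rwa [InnerProductSpace.toDual_apply_apply] at h2

theorem gradient_inner_le_of_convexOn {g : E → ℝ} (hg : Differentiable ℝ g)
    (hc : ConvexOn ℝ Set.univ g) (x y : E) :
    g x + inner ℝ (gradient g x) (y - x) ≤ g y := by
  have hc' : ConvexOn ℝ Set.univ (fun t : ℝ => g (x + t • (y - x))) := by
    have := hc.comp_affineMap (AffineMap.lineMap x y)
    simp only [Set.preimage_univ] at this
    refine this.congr fun t _ => ?_
    simp [AffineMap.lineMap_apply, add_comm]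
  have h := hc'.le_slope_of_hasDerivAt (Set.mem_univ 0) (Set.mem_univ 1) one_pos
    (hasDerivAt_comp_line hg x (y - x) 0)
  rw [slope_def_field, zero_smul, add_zero, one_smul, add_sub_cancel, sub_zero, div_one] at h
  linarith

/-- The descent lemma. -/
theorem le_of_lipschitz_gradient {g : E → ℝ} {L : ℝ} (hg : Differentiable ℝ g)
    (hL : ∀ y z, ‖gradient g y - gradient g z‖ ≤ L * ‖y - z‖) (x y : E) :
    g y ≤ g x + inner ℝ (gradient g x) (y - x) + L / 2 * ‖y - x‖ ^ 2 := by
  set v := y - x with hv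
  have hd : ∀ t : ℝ, HasDerivAt
      (fun t : ℝ => g (x + t • v) - t * inner ℝ (gradient g x) v - L / 2 * ‖v‖ ^ 2 * t ^ 2)
      (inner ℝ (gradient g (x + t • v)) v - inner ℝ (gradient g x) v
        - L / 2 * ‖v‖ ^ 2 * (2 * t)) t := by
    intro t
    have h1 := (hasDerivAt_comp_line hg x v t).sub
      ((hasDerivAt_id t).mul_const (inner ℝ (gradient g x) v))
    have h2 := h1.sub ((hasDerivAt_pow 2 t).const_mul (L / 2 * ‖v‖ ^ 2))
    refine h2.congr_deriv ?_
    push_cast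
    ring
  have hanti : AntitoneOn
      (fun t : ℝ => g (x + t • v) - t * inner ℝ (gradient g x) v - L / 2 * ‖v‖ ^ 2 * t ^ 2)
      (Set.Icc 0 1) := by
    refine antitoneOn_of_hasDerivWithinAt_nonpos (convex_Icc 0 1)
      (fun t _ => (hd t).continuousAt.continuousWithinAt)
      (fun t _ => (hd t).hasDerivWithinAt) fun t ht => ?_
    rw [interior_Icc] at ht
    have h1 : inner ℝ (gradient g (x + t • v)) v - inner ℝ (gradient g x) v
        ≤ L * (t * ‖v‖) * ‖v‖ := by
      rw [← inner_sub_left]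
      refine (real_inner_le_norm _ _).trans ?_
      gcongr
      refine (hL _ _).trans_eq ?_
      rw [add_sub_cancel_left, norm_smul, Real.norm_of_nonneg ht.1.le]
    nlinarith
  have h := hanti (Set.left_mem_Icc.2 zero_le_one) (Set.right_mem_Icc.2 zero_le_one) zero_le_one
  have h0 : x + v = y := add_sub_cancel _ _
  simp only [one_smul, zero_smul, add_zero, h0] at h
  linarith

/-- Compare the lower bound given by convexity at `x` with the upper bound given by the descent
lemma at `y`, both at the point reached from `y` by a gradient step on
`g - ⟪∇g x, ·⟫`. -/
theorem norm_gradient_sub_sq_le {g : E → ℝ} {L : ℝ} (hL0 : 0 < L) (hg : Differentiable ℝ g)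
    (hc : ConvexOn ℝ Set.univ g)
    (hL : ∀ y z, ‖gradient g y - gradient g z‖ ≤ L * ‖y - z‖) (x y : E) :
    g x + inner ℝ (gradient g x) (y - x) + (2 * L)⁻¹ * ‖gradient g y - gradient g x‖ ^ 2
      ≤ g y := by
  set u := gradient g y - gradient g x with hu
  have h1 := le_of_lipschitz_gradient hg hL y (y - L⁻¹ • u)
  have h2 := gradient_inner_le_of_convexOn hg hc x (y - L⁻¹ • u)
  have h3 : inner ℝ (gradient g y) u - inner ℝ (gradient g x) u = ‖u‖ ^ 2 := by
    rw [← inner_sub_left, real_inner_self_eq_norm_sq]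
  rw [show y - L⁻¹ • u - y = -(L⁻¹ • u) by abel, inner_neg_right, norm_neg, norm_smul,
    real_inner_smul_right, mul_pow, Real.norm_of_nonneg (by positivity)] at h1
  rw [show y - L⁻¹ • u - x = (y - x) - L⁻¹ • u by abel, inner_sub_right,
    real_inner_smul_right] at h2
  have h4 : L / 2 * (L⁻¹ ^ 2 * ‖u‖ ^ 2) = L⁻¹ / 2 * ‖u‖ ^ 2 := by field_simp
  have h5 : (2 * L)⁻¹ = L⁻¹ / 2 := by field_simp
  rw [h4] at h1
  rw [h5]
  have h6 : L⁻¹ * inner ℝ (gradient g y) u - L⁻¹ * inner ℝ (gradient g x) u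
      = L⁻¹ * ‖u‖ ^ 2 := by rw [← h3]; ring
  linarith

/-- Cocoercivity of the gradient of a convex smooth function (Baillon–Haddad). -/
theorem gradient_cocoercive {g : E → ℝ} {L : ℝ} (hL0 : 0 < L) (hg : Differentiable ℝ g)
    (hc : ConvexOn ℝ Set.univ g)
    (hL : ∀ y z, ‖gradient g y - gradient g z‖ ≤ L * ‖y - z‖) (x y : E) :
    L⁻¹ * ‖gradient g x - gradient g y‖ ^ 2
      ≤ inner ℝ (gradient g x - gradient g y) (x - y) := by
  have h1 := norm_gradient_sub_sq_le hL0 hg hc hL x y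
  have h2 := norm_gradient_sub_sq_le hL0 hg hc hL y x
  rw [norm_sub_rev] at h1
  have h3 : inner ℝ (gradient g x) (y - x) = - inner ℝ (gradient g x) (x - y) := by
    rw [← inner_neg_right, neg_sub]
  have h5 : (2 * L)⁻¹ = L⁻¹ / 2 := by field_simp
  rw [h5] at h1 h2
  rw [inner_sub_left]
  linarith

/-- The first-order lower bound of a strongly convex function. -/
theorem gradient_inner_add_sq_le_of_strongConvexOn {g : E → ℝ} {μ : ℝ}
    (hg : Differentiable ℝ g) (hs : StrongConvexOn Set.univ μ g) (x y : E) :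
    g x + inner ℝ (gradient g x) (y - x) + μ / 2 * ‖y - x‖ ^ 2 ≤ g y := by
  rw [strongConvexOn_iff_convex] at hs
  have hgr : ∀ z, HasGradientAt (fun x => g x - μ / 2 * ‖x‖ ^ 2) (gradient g z - μ • z) z := by
    intro z
    rw [hasGradientAt_iff_hasFDerivAt]
    have h1 := (hg z).hasGradientAt.hasFDerivAt.sub
      ((hasStrictFDerivAt_norm_sq z).hasFDerivAt.const_mul (μ / 2))
    refine h1.congr_fderiv ?_
    ext w
    simp
    ring
  have h := gradient_inner_le_of_convexOn (fun z => (hgr z).differentiableAt) hs x y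
  rw [(hgr x).gradient, inner_sub_left, real_inner_smul_left, inner_sub_right x,
    real_inner_self_eq_norm_sq] at h
  have h2 := norm_sub_sq_real y x
  rw [real_inner_comm] at h2
  rw [h2]
  linarith

theorem gradient_strongly_monotone {g : E → ℝ} {μ : ℝ}
    (hg : Differentiable ℝ g) (hs : StrongConvexOn Set.univ μ g) (x y : E) :
    μ * ‖x - y‖ ^ 2 ≤ inner ℝ (gradient g x - gradient g y) (x - y) := by
  have h1 := gradient_inner_add_sq_le_of_strongConvexOn hg hs x y
  have h2 := gradient_inner_add_sq_le_of_strongConvexOn hg hs y x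
  have h3 : inner ℝ (gradient g x) (y - x) = - inner ℝ (gradient g x) (x - y) := by
    rw [← inner_neg_right, neg_sub]
  rw [norm_sub_rev] at h1
  rw [inner_sub_left]
  linarith

end ConvexAnalysis

/-! ### The minimizer of the objective -/

section Minimizer

variable {n m d : ℕ}

theorem average_sub (x y : Models n d) : average (x - y) = average x - average y := by
  simp [average, smul_sub]

theorem average_add_smul (x v : Models n d) (t : ℝ) :
    average (x + t • v) = average x + t • average v := by
  simp only [average, Pi.add_apply, Pi.smul_apply, Finset.sum_add_distrib, smul_add,
    ← Finset.smul_sum]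
  rw [smul_comm]

theorem sum_sub_average (hn : 0 < n) (x : Models n d) : ∑ i, (x i - average x) = 0 := by
  have : (n : ℝ) ≠ 0 := by positivity
  rw [Finset.sum_sub_distrib, Finset.sum_const, Finset.card_univ, Fintype.card_fin,
    ← Nat.cast_smul_eq_nsmul ℝ, average, smul_inv_smul₀ this, sub_self]

theorem sum_inner_sub_average (hn : 0 < n) (x v : Models n d) :
    ∑ i, inner ℝ (x i - average x) (v i - average v) = ∑ i, inner ℝ (x i - average x) (v i) := by
  simp only [inner_sub_right (_ - _)]
  rw [Finset.sum_sub_distrib, ← sum_inner, sum_sub_average hn]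
  simp

theorem sum_norm_sub_average_sq (hn : 0 < n) (x : Models n d) :
    ∑ i, ‖x i - average x‖ ^ 2 = ∑ i, inner ℝ (x i - average x) (x i) := by
  rw [← sum_inner_sub_average hn]
  simp only [real_inner_self_eq_norm_sq]

theorem penalty_nonneg (x : Models n d) : 0 ≤ penalty x := by
  unfold penalty; positivity

theorem penalty_add_smul (hn : 0 < n) (x v : Models n d) (t : ℝ) :
    penalty (x + t • v) = penalty x + t * ((n : ℝ)⁻¹ * ∑ i, inner ℝ (x i - average x) (v i))
      + t ^ 2 * penalty v := by
  have h : ∀ i, ‖(x + t • v) i - average (x + t • v)‖ ^ 2 = ‖x i - average x‖ ^ 2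
      + 2 * t * inner ℝ (x i - average x) (v i - average v)
      + t ^ 2 * ‖v i - average v‖ ^ 2 := by
    intro i
    rw [average_add_smul, show (x + t • v) i - (average x + t • average v)
      = (x i - average x) + t • (v i - average v) by
        simp only [Pi.add_apply, Pi.smul_apply, smul_sub]; abel,
      norm_add_sq_real, real_inner_smul_right, norm_smul, mul_pow, Real.norm_eq_abs, sq_abs]
    ring
  simp only [penalty, h, Finset.sum_add_distrib, ← Finset.mul_sum, sum_inner_sub_average hn,
    mul_inv]
  ring

variable {f : Fin n → Fin m → Model d → ℝ} {L μ lam : ℝ}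

theorem hasGradientAt_localObjective (hf : ∀ i j, Differentiable ℝ (f i j)) (i : Fin n)
    (z : Model d) :
    HasGradientAt (localObjective f i) ((m : ℝ)⁻¹ • ∑ j, gradient (f i j) z) z := by
  rw [hasGradientAt_iff_hasFDerivAt]
  have h := (HasFDerivAt.fun_sum (u := Finset.univ) fun j _ =>
    ((hf i j) z).hasGradientAt.hasFDerivAt).const_mul (m : ℝ)⁻¹
  refine h.congr_fderiv ?_
  simp [map_sum]

theorem differentiable_localObjective (hf : ∀ i j, Differentiable ℝ (f i j)) (i : Fin n) :
    Differentiable ℝ (localObjective f i) :=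
  fun z => (hasGradientAt_localObjective hf i z).differentiableAt

theorem gradient_localObjective (hf : ∀ i j, Differentiable ℝ (f i j)) (i : Fin n)
    (z : Model d) :
    gradient (localObjective f i) z = (m : ℝ)⁻¹ • ∑ j, gradient (f i j) z :=
  (hasGradientAt_localObjective hf i z).gradient

theorem continuous_objective (hf : ∀ i j, Differentiable ℝ (f i j)) :
    Continuous (objective f lam) := by
  have h : ∀ i, Continuous (localObjective f i) := fun i =>
    (differentiable_localObjective hf i).continuous
  unfold objective penalty average
  fun_prop

theorem tendsto_objective_cocompact (hn : 0 < n) (hμ : 0 < μ) (hlam : 0 ≤ lam)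
    (hf : ∀ i j, Differentiable ℝ (f i j))
    (hs : ∀ i, StrongConvexOn Set.univ μ (localObjective f i)) :
    Filter.Tendsto (objective f lam) (Filter.cocompact (Models n d)) Filter.atTop := by
  -- each local objective is bounded below by a quadratic, after Young's inequality
  obtain ⟨c, hc⟩ : ∃ c : Fin n → ℝ, ∀ i z, c i + μ / 4 * ‖z‖ ^ 2 ≤ localObjective f i z := by
    refine ⟨fun i => localObjective f i 0 - μ⁻¹ * ‖gradient (localObjective f i) 0‖ ^ 2,
      fun i z => ?_⟩
    have h := gradient_inner_add_sq_le_of_strongConvexOn (differentiable_localObjective hf i)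
      (hs i) 0 z
    rw [sub_zero] at h
    have h2 := neg_le_of_abs_le (abs_real_inner_le_norm (gradient (localObjective f i) 0) z)
    set a := ‖gradient (localObjective f i) 0‖
    have h3 : a * ‖z‖ ≤ μ⁻¹ * a ^ 2 + μ / 4 * ‖z‖ ^ 2 := by
      have h5 : 0 ≤ μ⁻¹ * (a - μ / 2 * ‖z‖) ^ 2 := by positivity
      have h6 : μ⁻¹ * (a - μ / 2 * ‖z‖) ^ 2 = μ⁻¹ * a ^ 2 - a * ‖z‖ + μ / 4 * ‖z‖ ^ 2 := by
        field_simp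
        ring
      linarith
    linarith
  have hn' : (0 : ℝ) < n := by positivity
  have hlow : ∀ x : Models n d, (n : ℝ)⁻¹ * ∑ i, c i + (n : ℝ)⁻¹ * (μ / 4) * ‖x‖ ^ 2
      ≤ objective f lam x := by
    intro x
    have h1 : ‖x‖ ^ 2 ≤ ∑ i, ‖x i‖ ^ 2 := by
      have h2 : ‖x‖ ≤ √(∑ i, ‖x i‖ ^ 2) := by
        refine (pi_norm_le_iff_of_nonneg (Real.sqrt_nonneg _)).2 fun i => ?_
        refine Real.le_sqrt_of_sq_le ?_
        exact Finset.single_le_sum (f := fun i => ‖x i‖ ^ 2) (fun _ _ => by positivity)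
          (Finset.mem_univ i)
      calc ‖x‖ ^ 2 ≤ √(∑ i, ‖x i‖ ^ 2) ^ 2 := by gcongr
        _ = _ := Real.sq_sqrt (by positivity)
    have h2 : ∑ i, c i + μ / 4 * ∑ i, ‖x i‖ ^ 2 ≤ ∑ i, localObjective f i (x i) := by
      rw [Finset.mul_sum, ← Finset.sum_add_distrib]
      exact Finset.sum_le_sum fun i _ => hc i (x i)
    have h3 := mul_nonneg hlam (penalty_nonneg x)
    calc (n : ℝ)⁻¹ * ∑ i, c i + (n : ℝ)⁻¹ * (μ / 4) * ‖x‖ ^ 2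
        ≤ (n : ℝ)⁻¹ * ∑ i, c i + (n : ℝ)⁻¹ * (μ / 4) * ∑ i, ‖x i‖ ^ 2 := by gcongr
      _ = (n : ℝ)⁻¹ * (∑ i, c i + μ / 4 * ∑ i, ‖x i‖ ^ 2) := by ring
      _ ≤ (n : ℝ)⁻¹ * ∑ i, localObjective f i (x i) := by gcongr
      _ ≤ objective f lam x := le_add_of_nonneg_right h3
  refine Filter.tendsto_atTop_mono hlow ?_
  refine Filter.tendsto_atTop_add_const_left _ _ ?_
  refine Filter.Tendsto.const_mul_atTop (by positivity) ?_
  exact (Filter.tendsto_pow_atTop two_ne_zero).comp tendsto_norm_cocompact_atTop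

/-- The first-order optimality condition `∇f_i(x_i) + lam (x_i - x̄) = 0`, obtained by
differentiating the objective along the direction formed by these vectors. -/
theorem optimality_of_forall_le (hn : 0 < n) (hf : ∀ i j, Differentiable ℝ (f i j))
    {x : Models n d} (hx : ∀ y, objective f lam x ≤ objective f lam y) (i : Fin n) :
    gradient (localObjective f i) (x i) + lam • (x i - average x) = 0 := by
  set v : Models n d := fun i => gradient (localObjective f i) (x i) + lam • (x i - average x)
    with hv
  have hd : HasDerivAt (fun t : ℝ => objective f lam (x + t • v))
      ((n : ℝ)⁻¹ * ∑ i, inner ℝ (gradient (localObjective f i) (x i)) (v i)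
        + lam * ((n : ℝ)⁻¹ * ∑ i, inner ℝ (x i - average x) (v i))) 0 := by
    simp only [objective, penalty_add_smul hn]
    refine HasDerivAt.add (HasDerivAt.const_mul _ (HasDerivAt.fun_sum fun i _ => ?_))
      (HasDerivAt.const_mul _ ?_)
    · have h := hasDerivAt_comp_line (differentiable_localObjective hf i) (x i) (v i) 0
      rwa [zero_smul, add_zero] at h
    · have h := (((hasDerivAt_id (0 : ℝ)).mul_const
        ((n : ℝ)⁻¹ * ∑ i, inner ℝ (x i - average x) (v i))).const_add (penalty x)).add
        ((hasDerivAt_pow 2 (0 : ℝ)).mul_const (penalty v))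
      refine h.congr_deriv ?_
      simp
  have hmin : IsLocalMin (fun t : ℝ => objective f lam (x + t • v)) 0 := by
    refine Filter.Eventually.of_forall fun t => ?_
    simpa using hx (x + t • v)
  have h0 := hmin.hasDerivAt_eq_zero hd
  have h1 : ∑ i, ‖v i‖ ^ 2 = 0 := by
    have h2 : (n : ℝ)⁻¹ * ∑ i, ‖v i‖ ^ 2 = 0 := by
      rw [← h0]
      simp only [Finset.mul_sum, ← Finset.sum_add_distrib]
      refine Finset.sum_congr rfl fun i _ => ?_
      rw [← real_inner_self_eq_norm_sq]
      conv_lhs => rw [hv]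
      simp only [inner_add_left, real_inner_smul_left]
      ring
    have hn' : (n : ℝ)⁻¹ ≠ 0 := by positivity
    exact (mul_eq_zero.1 h2).resolve_left hn'
  have h2 := (Finset.sum_eq_zero_iff_of_nonneg fun i _ => by positivity).1 h1 i (Finset.mem_univ i)
  simpa using h2

/-- Two points satisfying the optimality condition coincide, because the gradient of the
objective is strongly monotone. -/
theorem eq_of_optimality (hn : 0 < n) (hμ : 0 < μ) (hlam : 0 ≤ lam)
    (hf : ∀ i j, Differentiable ℝ (f i j))
    (hs : ∀ i, StrongConvexOn Set.univ μ (localObjective f i)) {x y : Models n d}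
    (hx : ∀ i, gradient (localObjective f i) (x i) + lam • (x i - average x) = 0)
    (hy : ∀ i, gradient (localObjective f i) (y i) + lam • (y i - average y) = 0) : x = y := by
  have h1 : ∀ i, μ * ‖x i - y i‖ ^ 2
      ≤ - lam * inner ℝ ((x - y) i - average (x - y)) ((x - y) i) := by
    intro i
    refine (gradient_strongly_monotone (differentiable_localObjective hf i) (hs i) _ _).trans_eq ?_
    rw [eq_neg_of_add_eq_zero_left (hx i), eq_neg_of_add_eq_zero_left (hy i), average_sub,
      ← real_inner_smul_left]
    congr 1
    simp only [Pi.sub_apply, smul_sub, neg_smul]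
    abel
  have h2 := Finset.sum_le_sum fun i (_ : i ∈ Finset.univ) => h1 i
  rw [← Finset.mul_sum, ← Finset.mul_sum, ← sum_norm_sub_average_sq hn] at h2
  have h3 : 0 ≤ lam * ∑ i, ‖(x - y) i - average (x - y)‖ ^ 2 := by positivity
  have h4 : ∑ i, ‖x i - y i‖ ^ 2 = 0 := by
    refine le_antisymm ?_ (by positivity)
    by_contra! h
    have := mul_pos hμ h
    linarith
  funext i
  have h5 := (Finset.sum_eq_zero_iff_of_nonneg fun i _ => by positivity).1 h4 i (Finset.mem_univ i)
  exact sub_eq_zero.1 (by simpa using h5)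

end Minimizer

/-! ### One step of the method in expectation -/

section OneStep

/-- The bound on a gradient step along the variance-reduced estimator `U - Z + 𝔼 Z` of `𝔼 U`. -/
theorem sum_weight_norm_sub_smul_sq_le {E ι : Type*} [NormedAddCommGroup E]
    [InnerProductSpace ℝ E] [Fintype ι] {w : ι → ℝ} (hw : ∀ r, 0 ≤ w r) (hw1 : ∑ r, w r = 1)
    (D : E) (U Z : ι → E) (β : ℝ) :
    ∑ r, w r * ‖D - β • (U r - Z r + ∑ r, w r • Z r)‖ ^ 2
      ≤ ‖D‖ ^ 2 - 2 * β * inner ℝ D (∑ r, w r • U r)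
        + 2 * β ^ 2 * (∑ r, w r * ‖U r‖ ^ 2 + ∑ r, w r * ‖Z r‖ ^ 2) := by
  set M := ∑ r, w r • Z r with hM
  have hpt : ∀ r, ‖D - β • (U r - Z r + M)‖ ^ 2 ≤ ‖D‖ ^ 2
      - 2 * β * (inner ℝ D (U r) - inner ℝ D (Z r) + inner ℝ D M)
      + 2 * β ^ 2 * (‖U r‖ ^ 2 + ‖Z r‖ ^ 2 - 2 * inner ℝ M (Z r) + ‖M‖ ^ 2) := by
    intro r
    have h1 : ‖U r - Z r + M‖ ^ 2 ≤ 2 * (‖U r‖ ^ 2 + ‖M - Z r‖ ^ 2) := by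
      rw [show U r - Z r + M = U r + (M - Z r) by abel]
      exact (pow_le_pow_left₀ (norm_nonneg _) (norm_add_le _ _) 2).trans (add_sq_le)
    have h2 := norm_sub_sq_real M (Z r)
    rw [norm_sub_sq_real, real_inner_smul_right, inner_add_right, inner_sub_right, norm_smul,
      mul_pow, Real.norm_eq_abs, sq_abs]
    nlinarith [mul_le_mul_of_nonneg_left h1 (sq_nonneg β)]
  have hU : inner ℝ D (∑ r, w r • U r) = ∑ r, w r * inner ℝ D (U r) := by
    simp [inner_sum, real_inner_smul_right]
  have hZ : inner ℝ D M = ∑ r, w r * inner ℝ D (Z r) := by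
    simp [hM, inner_sum, real_inner_smul_right]
  have hMM : ‖M‖ ^ 2 = ∑ r, w r * inner ℝ M (Z r) := by
    rw [← real_inner_self_eq_norm_sq]
    conv_lhs => rw [hM, inner_sum]
    simp [real_inner_smul_right, ← hM]
  have hcalc : ∑ r, w r * (‖D‖ ^ 2
      - 2 * β * (inner ℝ D (U r) - inner ℝ D (Z r) + inner ℝ D M)
      + 2 * β ^ 2 * (‖U r‖ ^ 2 + ‖Z r‖ ^ 2 - 2 * inner ℝ M (Z r) + ‖M‖ ^ 2))
      = (∑ r, w r) * (‖D‖ ^ 2 - 2 * β * inner ℝ D M + 2 * β ^ 2 * ‖M‖ ^ 2)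
        - 2 * β * (∑ r, w r * inner ℝ D (U r) - ∑ r, w r * inner ℝ D (Z r))
        + 2 * β ^ 2 * (∑ r, w r * ‖U r‖ ^ 2 + ∑ r, w r * ‖Z r‖ ^ 2
          - 2 * ∑ r, w r * inner ℝ M (Z r)) := by
    simp only [Finset.sum_mul, Finset.mul_sum, ← Finset.sum_add_distrib, ← Finset.sum_sub_distrib]
    exact Finset.sum_congr rfl fun r _ => by ring
  refine (Finset.sum_le_sum fun r _ => mul_le_mul_of_nonneg_left (hpt r) (hw r)).trans ?_
  rw [hcalc, hw1, ← hU, ← hZ, ← hMM]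
  nlinarith [mul_nonneg (sq_nonneg β) (sq_nonneg ‖M‖)]

/-- The probability that, in one iteration, the coin shows `r.1` and a given device samples the
data point `r.2`. -/
noncomputable def roundWeight {m : ℕ} (p : ℝ) (r : Bool × Fin m) : ℝ :=
  (if r.1 then p else 1 - p) * (m : ℝ)⁻¹

variable {n m d : ℕ} {p : ℝ}

theorem sum_roundWeight_smul {E : Type*} [AddCommGroup E] [Module ℝ E] (h : Bool × Fin m → E) :
    ∑ r, roundWeight p r • h r
      = p • (m : ℝ)⁻¹ • ∑ j, h (true, j) + (1 - p) • (m : ℝ)⁻¹ • ∑ j, h (false, j) := by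
  simp [Fintype.sum_prod_type, roundWeight, mul_smul, Finset.smul_sum]

theorem sum_roundWeight_mul (h : Bool × Fin m → ℝ) :
    ∑ r, roundWeight p r * h r
      = p * ((m : ℝ)⁻¹ * ∑ j, h (true, j)) + (1 - p) * ((m : ℝ)⁻¹ * ∑ j, h (false, j)) :=
  sum_roundWeight_smul h

theorem inv_smul_sum_const {E : Type*} [AddCommGroup E] [Module ℝ E] (hm : 0 < m) (a : E) :
    (m : ℝ)⁻¹ • ∑ _j : Fin m, a = a := by
  have : (m : ℝ) ≠ 0 := by positivity
  rw [Finset.sum_const, Finset.card_univ, Fintype.card_fin, ← Nat.cast_smul_eq_nsmul ℝ,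
    inv_smul_smul₀ this]

theorem inv_mul_sum_const (hm : 0 < m) (a : ℝ) : (m : ℝ)⁻¹ * ∑ _j : Fin m, a = a :=
  inv_smul_sum_const hm a

theorem roundWeight_nonneg (hp0 : 0 < p) (hp1 : p < 1) (r : Bool × Fin m) :
    0 ≤ roundWeight p r := by
  have : 0 ≤ 1 - p := by linarith
  unfold roundWeight
  split <;> positivity

theorem sum_roundWeight (hm : 0 < m) : ∑ r : Bool × Fin m, roundWeight p r = 1 := by
  have h := sum_roundWeight_mul (p := p) (m := m) fun _ => 1
  simp only [mul_one, inv_mul_sum_const hm] at h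
  rw [h]
  ring

/-- Dividing each outcome of the coin by its probability gives an unbiased estimator of the sum
of the two parts. -/
theorem sum_roundWeight_smul_importance {E : Type*} [AddCommGroup E] [Module ℝ E] (hm : 0 < m)
    (hp0 : 0 < p) (hp1 : p < 1) (A : Fin m → E) (B : E) :
    ∑ r : Bool × Fin m, roundWeight p r • (if r.1 then p⁻¹ • B else (1 - p)⁻¹ • A r.2)
      = (m : ℝ)⁻¹ • ∑ j, A j + B := by
  have hq : 1 - p ≠ 0 := by linarith
  rw [sum_roundWeight_smul]
  simp only [if_true, Bool.false_eq_true, if_false, inv_smul_sum_const hm]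
  rw [← Finset.smul_sum, smul_inv_smul₀ hp0.ne', smul_comm (m : ℝ)⁻¹, smul_inv_smul₀ hq, add_comm]

theorem sum_roundWeight_norm_importance_sq {E : Type*} [NormedAddCommGroup E] [NormedSpace ℝ E]
    (hm : 0 < m) (hp0 : 0 < p) (hp1 : p < 1) (A : Fin m → E) (B : E) :
    ∑ r : Bool × Fin m, roundWeight p r * ‖if r.1 then p⁻¹ • B else (1 - p)⁻¹ • A r.2‖ ^ 2
      = (1 - p)⁻¹ * ((m : ℝ)⁻¹ * ∑ j, ‖A j‖ ^ 2) + p⁻¹ * ‖B‖ ^ 2 := by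
  have hq : 1 - p ≠ 0 := by linarith
  rw [sum_roundWeight_mul]
  simp only [if_true, Bool.false_eq_true, if_false, inv_mul_sum_const hm, norm_smul, mul_pow,
    Real.norm_eq_abs, sq_abs]
  rw [← Finset.mul_sum]
  have h1 : p * (p⁻¹ ^ 2 * ‖B‖ ^ 2) = p⁻¹ * ‖B‖ ^ 2 := by field_simp
  have h2 : (1 - p) * (1 - p)⁻¹ ^ 2 = (1 - p)⁻¹ := by field_simp
  rw [h1]
  linear_combination ((m : ℝ)⁻¹ * ∑ j, ‖A j‖ ^ 2) * h2

variable {f : Fin n → Fin m → Model d → ℝ} {L μ lam α : ℝ}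

/-- The contribution of device `i` to the Lyapunov function. -/
noncomputable def deviceLyapunov (f : Fin n → Fin m → Model d → ℝ) (lam p α L : ℝ) (xs : Models n d)
    (S : State n m d) (i : Fin n) : ℝ :=
  ‖S.x i - xs i‖ ^ 2
    + α * ((2 * (n : ℝ) * (1 - p) * L)⁻¹ * ∑ j, ‖S.J i j - gradient (f i j) (xs i)‖ ^ 2
      + (2 * (n : ℝ) * p * lam)⁻¹ * ‖S.Psi i - lam • (xs i - average xs)‖ ^ 2)

theorem lyapunov_eq_sum (xs : Models n d) (S : State n m d) :
    lyapunov f lam p α L xs S = ∑ i, deviceLyapunov f lam p α L xs S i := by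
  simp only [lyapunov, sqDist, deviceLyapunov, Finset.sum_add_distrib, ← Finset.mul_sum]

/-- Device `i` only sees its own sample. -/
theorem deviceLyapunov_step (xs : Models n d) (S : State n m d) (coin : Bool)
    (s : Fin n → Fin m) (i : Fin n) :
    deviceLyapunov f lam p α L xs (step f lam p α coin s S) i
      = deviceLyapunov f lam p α L xs (step f lam p α coin (fun _ => s i) S) i := by
  cases coin <;> rfl

theorem sum_update_norm_sub_sq {E : Type*} [NormedAddCommGroup E] (J a : Fin m → E) (j : Fin m)
    (b : E) :
    ∑ l, ‖Function.update J j b l - a l‖ ^ 2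
      = ∑ l, ‖J l - a l‖ ^ 2 - ‖J j - a j‖ ^ 2 + ‖b - a j‖ ^ 2 := by
  rw [← Finset.add_sum_erase _ _ (Finset.mem_univ j),
    ← Finset.add_sum_erase _ (fun l => ‖J l - a l‖ ^ 2) (Finset.mem_univ j),
    Finset.sum_congr rfl fun l hl => by
      rw [Function.update_of_ne (Finset.ne_of_mem_erase hl)], Function.update_self]
  ring

section Device

variable (S : State n m d) (xs : Models n d) (i : Fin n)

theorem sum_weight_norm_step_x_sub_sq_le (hn : 0 < n) (hm : 0 < m) (hp0 : 0 < p) (hp1 : p < 1)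
    (hopt : (m : ℝ)⁻¹ • ∑ j, gradient (f i j) (xs i) + lam • (xs i - average xs) = 0) :
    ∑ r : Bool × Fin m,
        roundWeight p r * ‖(step f lam p α r.1 (fun _ => r.2) S).x i - xs i‖ ^ 2
      ≤ ‖S.x i - xs i‖ ^ 2
        - 2 * (α / n) * inner ℝ (S.x i - xs i)
          ((m : ℝ)⁻¹ • ∑ j, (gradient (f i j) (S.x i) - gradient (f i j) (xs i))
            + (lam • (S.x i - average S.x) - lam • (xs i - average xs)))
        + 2 * (α / n) ^ 2 *
          ((1 - p)⁻¹ * ((m : ℝ)⁻¹ *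
              ∑ j, ‖gradient (f i j) (S.x i) - gradient (f i j) (xs i)‖ ^ 2)
            + p⁻¹ * ‖lam • (S.x i - average S.x) - lam • (xs i - average xs)‖ ^ 2
            + (1 - p)⁻¹ * ((m : ℝ)⁻¹ * ∑ j, ‖S.J i j - gradient (f i j) (xs i)‖ ^ 2)
            + p⁻¹ * ‖S.Psi i - lam • (xs i - average xs)‖ ^ 2) := by
  have hq : (1 - p) ≠ 0 := by linarith
  have hp : p ≠ 0 := hp0.ne'
  have hn' : (n : ℝ) ≠ 0 := by positivity
  have hm' : (m : ℝ) ≠ 0 := by positivity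
  set A : Fin m → Model d := fun j => gradient (f i j) (S.x i) - gradient (f i j) (xs i) with hA
  set H : Fin m → Model d := fun j => S.J i j - gradient (f i j) (xs i) with hH
  set b := lam • (xs i - average xs) with hb
  set B := lam • (S.x i - average S.x) - b with hB
  set Q := S.Psi i - b with hQ
  set U : Bool × Fin m → Model d := fun r => if r.1 then p⁻¹ • B else (1 - p)⁻¹ • A r.2 with hU
  set Z : Bool × Fin m → Model d := fun r => if r.1 then p⁻¹ • Q else (1 - p)⁻¹ • H r.2 with hZ
  have key := sum_weight_norm_sub_smul_sq_le (roundWeight_nonneg hp0 hp1)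
    (sum_roundWeight hm) (S.x i - xs i) U Z (α / n)
  have hEU : ∑ r, roundWeight p r • U r = (m : ℝ)⁻¹ • ∑ j, A j + B :=
    sum_roundWeight_smul_importance hm hp0 hp1 A B
  have hEZ : ∑ r, roundWeight p r • Z r = (m : ℝ)⁻¹ • ∑ j, H j + Q :=
    sum_roundWeight_smul_importance hm hp0 hp1 H Q
  have hUU : ∑ r, roundWeight p r * ‖U r‖ ^ 2
      = (1 - p)⁻¹ * ((m : ℝ)⁻¹ * ∑ j, ‖A j‖ ^ 2) + p⁻¹ * ‖B‖ ^ 2 :=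
    sum_roundWeight_norm_importance_sq hm hp0 hp1 A B
  have hZZ : ∑ r, roundWeight p r * ‖Z r‖ ^ 2
      = (1 - p)⁻¹ * ((m : ℝ)⁻¹ * ∑ j, ‖H j‖ ^ 2) + p⁻¹ * ‖Q‖ ^ 2 :=
    sum_roundWeight_norm_importance_sq hm hp0 hp1 H Q
  -- the optimality condition turns `J_i` and `Ψ_i` into their deviations from the optimal values
  have hHsum : (m : ℝ)⁻¹ • ∑ j, H j = (m : ℝ)⁻¹ • ∑ j, S.J i j + b := by
    rw [eq_neg_of_add_eq_zero_right hopt]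
    simp only [hH, Finset.sum_sub_distrib, smul_sub]
    abel
  have hstep : ∀ r : Bool × Fin m, (step f lam p α r.1 (fun _ => r.2) S).x i - xs i
      = (S.x i - xs i) - (α / n) • (U r - Z r + ∑ r, roundWeight p r • Z r) := by
    rintro ⟨c, j⟩
    rw [hEZ, hHsum]
    generalize hT : ∑ j, S.J i j = T
    cases c
    · simp only [step, localStep, localDirection, hU, hZ, hA, hH, hQ, hT, Bool.false_eq_true,
        if_false]
      clear_value b
      match_scalars <;> field_simp <;> ring
    · simp only [step, aggregationStep, aggregationDirection, hU, hZ, hB, hQ, hT, if_true]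
      clear_value b
      generalize S.x i - average S.x = y
      match_scalars <;> field_simp <;> ring
  simp only [hstep]
  refine key.trans_eq ?_
  rw [hEU, hUU, hZZ]
  ring

theorem sum_weight_norm_step_J_sub_sq (hm : 0 < m) :
    ∑ r : Bool × Fin m, roundWeight p r *
        ∑ l, ‖(step f lam p α r.1 (fun _ => r.2) S).J i l - gradient (f i l) (xs i)‖ ^ 2
      = (1 - p) * ((m : ℝ)⁻¹ *
          ∑ j, ‖gradient (f i j) (S.x i) - gradient (f i j) (xs i)‖ ^ 2)
        + (1 - (1 - p) * (m : ℝ)⁻¹) * ∑ j, ‖S.J i j - gradient (f i j) (xs i)‖ ^ 2 := by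
  rw [sum_roundWeight_mul]
  simp only [step, localStep, aggregationStep, if_true, Bool.false_eq_true, if_false,
    sum_update_norm_sub_sq, inv_mul_sum_const hm, Finset.sum_add_distrib,
    Finset.sum_sub_distrib, mul_add, mul_sub]
  ring

theorem sum_weight_norm_step_Psi_sub_sq (hm : 0 < m) (b : Model d) :
    ∑ r : Bool × Fin m, roundWeight p r *
        ‖(step f lam p α r.1 (fun _ => r.2) S).Psi i - b‖ ^ 2
      = p * ‖lam • (S.x i - average S.x) - b‖ ^ 2 + (1 - p) * ‖S.Psi i - b‖ ^ 2 := by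
  rw [sum_roundWeight_mul]
  simp only [step, localStep, aggregationStep, if_true, Bool.false_eq_true, if_false,
    inv_mul_sum_const hm]

end Device

end OneStep

/-! ### Contraction of the Lyapunov function -/

section Contraction

variable {n m d : ℕ} {f : Fin n → Fin m → Model d → ℝ} {L μ lam p β : ℝ}

/-- Half of strong monotonicity plus half of cocoercivity. -/
theorem inner_mean_gradient_sub_ge (hL : 0 < L)
    (hconv : ∀ i j, ConvexOn ℝ Set.univ (f i j)) (hsmooth : ∀ i j, IsSmooth L (f i j))
    (hstrong : ∀ i, StrongConvexOn Set.univ μ (localObjective f i)) (i : Fin n) (y z : Model d) :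
    μ / 2 * ‖y - z‖ ^ 2
        + (2 * L)⁻¹ * ((m : ℝ)⁻¹ * ∑ j, ‖gradient (f i j) y - gradient (f i j) z‖ ^ 2)
      ≤ inner ℝ (y - z) ((m : ℝ)⁻¹ • ∑ j, (gradient (f i j) y - gradient (f i j) z)) := by
  have hf : ∀ i j, Differentiable ℝ (f i j) := fun i j => (hsmooth i j).1
  have h1 := gradient_strongly_monotone (differentiable_localObjective hf i) (hstrong i) y z
  rw [gradient_localObjective hf, gradient_localObjective hf, ← smul_sub,
    ← Finset.sum_sub_distrib, real_inner_comm] at h1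
  have h2 : L⁻¹ * ((m : ℝ)⁻¹ * ∑ j, ‖gradient (f i j) y - gradient (f i j) z‖ ^ 2)
      ≤ inner ℝ (y - z) ((m : ℝ)⁻¹ • ∑ j, (gradient (f i j) y - gradient (f i j) z)) := by
    rw [real_inner_smul_right, inner_sum, mul_left_comm, Finset.mul_sum]
    gcongr with j
    rw [real_inner_comm]
    exact gradient_cocoercive hL (hsmooth i j).1 (hconv i j) (hsmooth i j).2 y z
  have h3 : (2 * L)⁻¹ = L⁻¹ / 2 := by field_simp
  rw [h3]
  linarith

/-- The contraction at one device, up to a term in the deviation of `lam (x_i - x̄)`, which only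
becomes nonpositive after summation over the devices. -/
theorem sum_weight_deviceLyapunov_step_le (hn : 0 < n) (hm : 0 < m) (hL : 0 < L)
    (hlam : 0 ≤ lam) (hp0 : 0 < p) (hp1 : p < 1)
    (hconv : ∀ i j, ConvexOn ℝ Set.univ (f i j)) (hsmooth : ∀ i j, IsSmooth L (f i j))
    (hstrong : ∀ i, StrongConvexOn Set.univ μ (localObjective f i))
    (hβ : 0 < β) (hβ1 : β * (4 * L + μ * m) ≤ 1 - p) (hβ2 : β * (4 * lam + μ) ≤ p) (hμ : 0 < μ)
    {xs : Models n d}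
    (hopt : ∀ i, gradient (localObjective f i) (xs i) + lam • (xs i - average xs) = 0)
    {S : State n m d} (hS : lam = 0 → S.Psi = 0) (i : Fin n) :
    ∑ r : Bool × Fin m, roundWeight p r *
        deviceLyapunov f lam p (n * β) L xs
          (step f lam p (n * β) r.1 (fun _ => r.2) S) i
      ≤ (1 - β * μ) * deviceLyapunov f lam p (n * β) L xs S i
        + (-2 * β * inner ℝ (S.x i - xs i)
              (lam • (S.x i - average S.x) - lam • (xs i - average xs))
          + (2 * β ^ 2 * p⁻¹ + β * (2 * p * lam)⁻¹ * p)
            * ‖lam • (S.x i - average S.x) - lam • (xs i - average xs)‖ ^ 2) := by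
  have hn' : (0 : ℝ) < n := by positivity
  have hm' : (0 : ℝ) < m := by positivity
  have hq : 0 < 1 - p := by linarith
  have hopt' := hopt i
  rw [gradient_localObjective fun i j => (hsmooth i j).1] at hopt'
  have hx := sum_weight_norm_step_x_sub_sq_le (lam := lam) (α := n * β) S xs i hn hm hp0 hp1 hopt'
  have hJ := sum_weight_norm_step_J_sub_sq (f := f) (lam := lam) (p := p) (α := n * β) S xs i hm
  have hP := sum_weight_norm_step_Psi_sub_sq (f := f) (lam := lam) (p := p) (α := n * β) S i hm
    (lam • (xs i - average xs))
  have hin := inner_mean_gradient_sub_ge hL hconv hsmooth hstrong i (S.x i) (xs i)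
  rw [mul_div_cancel_left₀ _ hn'.ne', inner_add_right] at hx
  have hc1 : n * β * (2 * n * (1 - p) * L)⁻¹ = β * (2 * (1 - p) * L)⁻¹ := by field_simp
  have hc2 : n * β * (2 * n * p * lam)⁻¹ = β * (2 * p * lam)⁻¹ := by
    rw [show 2 * n * p * lam = n * (2 * p * lam) by ring, mul_inv]
    field_simp
  have hdev : ∀ T : State n m d, deviceLyapunov f lam p (n * β) L xs T i
      = ‖T.x i - xs i‖ ^ 2
        + (β * (2 * (1 - p) * L)⁻¹ * ∑ j, ‖T.J i j - gradient (f i j) (xs i)‖ ^ 2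
        + β * (2 * p * lam)⁻¹ * ‖T.Psi i - lam • (xs i - average xs)‖ ^ 2) := by
    intro T
    rw [deviceLyapunov, mul_add, ← mul_assoc, ← mul_assoc, hc1, hc2]
  simp only [hdev, mul_add, mul_left_comm (roundWeight p _), Finset.sum_add_distrib,
    ← Finset.mul_sum, hJ, hP]
  set a := (m : ℝ)⁻¹ * ∑ j, ‖gradient (f i j) (S.x i) - gradient (f i j) (xs i)‖ ^ 2
  set h := ∑ j, ‖S.J i j - gradient (f i j) (xs i)‖ ^ 2
  set b := ‖lam • (S.x i - average S.x) - lam • (xs i - average xs)‖ ^ 2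
  have ha0 : 0 ≤ a := by positivity
  have hh0 : 0 ≤ h := by positivity
  -- the coefficients of `a`, `h` and of the deviation of `Ψ_i`
  have hA : 2 * β ^ 2 * (1 - p)⁻¹ + β * (2 * (1 - p) * L)⁻¹ * (1 - p) ≤ 2 * β * (2 * L)⁻¹ := by
    have h1 : β * (4 * L) ≤ 1 - p := by nlinarith [mul_pos hβ (mul_pos hμ hm')]
    have h2 : 2 * β * (2 * L)⁻¹
        - (2 * β ^ 2 * (1 - p)⁻¹ + β * (2 * (1 - p) * L)⁻¹ * (1 - p))
        = β * (2 * (1 - p) * L)⁻¹ * ((1 - p) - β * (4 * L)) := by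
      field_simp
      ring
    have h3 : 0 ≤ β * (2 * (1 - p) * L)⁻¹ * ((1 - p) - β * (4 * L)) := by
      have := sub_nonneg.2 h1
      positivity
    linarith
  have hH : 2 * β ^ 2 * (1 - p)⁻¹ * (m : ℝ)⁻¹
      + β * (2 * (1 - p) * L)⁻¹ * (1 - (1 - p) * (m : ℝ)⁻¹)
      ≤ (1 - β * μ) * (β * (2 * (1 - p) * L)⁻¹) := by
    have h2 : (1 - β * μ) * (β * (2 * (1 - p) * L)⁻¹)
        - (2 * β ^ 2 * (1 - p)⁻¹ * (m : ℝ)⁻¹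
          + β * (2 * (1 - p) * L)⁻¹ * (1 - (1 - p) * (m : ℝ)⁻¹))
        = β * (2 * (1 - p) * L * m)⁻¹ * ((1 - p) - β * (4 * L + μ * m)) := by
      field_simp
      ring
    have h3 : 0 ≤ β * (2 * (1 - p) * L * m)⁻¹ * ((1 - p) - β * (4 * L + μ * m)) := by
      have := sub_nonneg.2 hβ1
      positivity
    linarith
  have hQ : (2 * β ^ 2 * p⁻¹ + β * (2 * p * lam)⁻¹ * (1 - p))
        * ‖S.Psi i - lam • (xs i - average xs)‖ ^ 2
      ≤ (1 - β * μ) * (β * (2 * p * lam)⁻¹)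
        * ‖S.Psi i - lam • (xs i - average xs)‖ ^ 2 := by
    rcases hlam.eq_or_lt with h0 | hlam0
    · -- here `(2 * p * lam)⁻¹` is `0`, so the term in `β ^ 2` has to vanish by itself
      rw [hS h0.symm, ← h0]
      simp
    · refine mul_le_mul_of_nonneg_right ?_ (by positivity)
      have h2 : (1 - β * μ) * (β * (2 * p * lam)⁻¹)
          - (2 * β ^ 2 * p⁻¹ + β * (2 * p * lam)⁻¹ * (1 - p))
          = β * (2 * p * lam)⁻¹ * (p - β * (4 * lam + μ)) := by
        field_simp
        ring
      have h3 : 0 ≤ β * (2 * p * lam)⁻¹ * (p - β * (4 * lam + μ)) := by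
        have := sub_nonneg.2 hβ2
        positivity
      linarith
  have hin' := mul_le_mul_of_nonneg_left hin (by positivity : 0 ≤ 2 * β)
  have hA' := mul_le_mul_of_nonneg_right hA ha0
  have hH' := mul_le_mul_of_nonneg_right hH hh0
  have hr : (1 - p)⁻¹ * ((m : ℝ)⁻¹ * h) = (1 - p)⁻¹ * (m : ℝ)⁻¹ * h := by ring
  linarith

theorem sum_consensus_terms_nonpos (hn : 0 < n) (hlam : 0 ≤ lam) (hp0 : 0 < p) (hβ : 0 < β)
    (hμ : 0 < μ) (hβ2 : β * (4 * lam + μ) ≤ p) (x y : Models n d) :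
    ∑ i, (-2 * β * inner ℝ (x i - y i) (lam • (x i - average x) - lam • (y i - average y))
        + (2 * β ^ 2 * p⁻¹ + β * (2 * p * lam)⁻¹ * p)
          * ‖lam • (x i - average x) - lam • (y i - average y)‖ ^ 2) ≤ 0 := by
  have hd : ∀ i, lam • (x i - average x) - lam • (y i - average y)
      = lam • ((x - y) i - average (x - y)) := by
    intro i
    rw [average_sub, ← smul_sub, Pi.sub_apply]
    congr 1
    abel
  have hsum := sum_norm_sub_average_sq hn (x - y)
  simp only [hd, norm_smul, mul_pow, Real.norm_eq_abs, sq_abs, real_inner_smul_right,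
    ← Pi.sub_apply x y, real_inner_comm, Finset.sum_add_distrib, ← Finset.mul_sum] at hsum ⊢
  rw [← hsum]
  set X := ∑ i, ‖(x - y) i - average (x - y)‖ ^ 2
  have hX : 0 ≤ X := by positivity
  rcases hlam.eq_or_lt with h0 | hlam0
  · rw [← h0]
    simp
  · have h1 : β * (4 * lam) ≤ p := by nlinarith [mul_pos hβ hμ]
    have h2 : -2 * β * (lam * X) + (2 * β ^ 2 * p⁻¹ + β * (2 * p * lam)⁻¹ * p) * (lam ^ 2 * X)
        = - (β * lam * X * p⁻¹ * (p + (1 / 2) * (p - β * (4 * lam)))) := by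
      field_simp
      ring
    rw [h2, neg_nonpos]
    have := sub_nonneg.2 h1
    positivity

/-- One round contracts the Lyapunov function in expectation. -/
theorem sum_weight_lyapunov_step_le (hn : 0 < n) (hm : 0 < m) (hL : 0 < L)
    (hlam : 0 ≤ lam) (hp0 : 0 < p) (hp1 : p < 1)
    (hconv : ∀ i j, ConvexOn ℝ Set.univ (f i j)) (hsmooth : ∀ i j, IsSmooth L (f i j))
    (hstrong : ∀ i, StrongConvexOn Set.univ μ (localObjective f i))
    (hβ : 0 < β) (hβ1 : β * (4 * L + μ * m) ≤ 1 - p) (hβ2 : β * (4 * lam + μ) ≤ p) (hμ : 0 < μ)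
    {xs : Models n d}
    (hopt : ∀ i, gradient (localObjective f i) (xs i) + lam • (xs i - average xs) = 0)
    {S : State n m d} (hS : lam = 0 → S.Psi = 0) :
    ∑ i, ∑ r : Bool × Fin m, roundWeight p r *
        deviceLyapunov f lam p (n * β) L xs (step f lam p (n * β) r.1 (fun _ => r.2) S) i
      ≤ (1 - β * μ) * lyapunov f lam p (n * β) L xs S := by
  have h := Finset.sum_le_sum fun i (_ : i ∈ Finset.univ) =>
    sum_weight_deviceLyapunov_step_le hn hm hL hlam hp0 hp1 hconv hsmooth hstrong hβ hβ1 hβ2 hμ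
      hopt hS i
  rw [Finset.sum_add_distrib, ← Finset.mul_sum, ← lyapunov_eq_sum] at h
  have h2 := sum_consensus_terms_nonpos hn hlam hp0 hβ hμ hβ2 S.x xs
  linarith

/-- Without penalty the control variates `Ψ_i` stay zero. -/
theorem run_Psi_eq_zero (hlam : lam = 0) (p α : ℝ) (x0 : Model d) (coin : ℕ → Bool)
    (s : ℕ → Fin n → Fin m) (k : ℕ) : (run f lam p α x0 coin s k).Psi = 0 := by
  induction k with
  | zero => rfl
  | succ k ih =>
    rw [run, step]
    split
    · funext i
      simp [aggregationStep, hlam]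
    · exact ih

theorem run_congr (lam p α : ℝ) (x0 : Model d) {coin coin' : ℕ → Bool}
    {s s' : ℕ → Fin n → Fin m} {k : ℕ} (hc : ∀ t < k, coin t = coin' t)
    (hs : ∀ t < k, s t = s' t) :
    run f lam p α x0 coin s k = run f lam p α x0 coin' s' k := by
  induction k with
  | zero => rfl
  | succ k ih =>
    rw [run, run, hc k k.lt_succ_self, hs k k.lt_succ_self,
      ih (fun t ht => hc t (ht.trans k.lt_succ_self)) fun t ht => hs t (ht.trans k.lt_succ_self)]

theorem sqDist_nonneg (x y : Models n d) : 0 ≤ sqDist x y := by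
  unfold sqDist; positivity

theorem sqDist_le_lyapunov {α : ℝ} (hα : 0 ≤ α) (hL : 0 ≤ L) (hlam : 0 ≤ lam) (hp0 : 0 ≤ p)
    (hp1 : p ≤ 1) (xs : Models n d) (S : State n m d) :
    sqDist S.x xs ≤ lyapunov f lam p α L xs S := by
  have hq : 0 ≤ 1 - p := sub_nonneg.2 hp1
  unfold lyapunov
  exact le_add_of_nonneg_right (by positivity)

end Contraction

/-! ### The randomness of the method -/

section Randomness

theorem integral_comp_le_of_indepFun {Ω A B : Type*} [MeasurableSpace Ω] {P : Measure Ω}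
    [IsProbabilityMeasure P] [Finite A] [Finite B] [MeasurableSpace A] [MeasurableSpace B]
    [MeasurableSingletonClass A] [MeasurableSingletonClass B] {X : Ω → A} {Y : Ω → B}
    (hX : Measurable X) (hY : Measurable Y) (hXY : IndepFun X Y P) {g : A → B → ℝ} {c : A → ℝ}
    (hg : ∀ a, ∫ ω, g a (Y ω) ∂P ≤ c a) :
    ∫ ω, g (X ω) (Y ω) ∂P ≤ ∫ ω, c (X ω) ∂P := by
  have hXp := Measure.isProbabilityMeasure_map (μ := P) hX.aemeasurable
  have hYp := Measure.isProbabilityMeasure_map (μ := P) hY.aemeasurable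
  have h1 : ∫ ω, g (X ω) (Y ω) ∂P = ∫ z, g z.1 z.2 ∂((P.map X).prod (P.map Y)) := by
    rw [← hXY.map_prod_eq_prod_map_map hX.aemeasurable hY.aemeasurable,
      integral_map (hX.prodMk hY).aemeasurable (by fun_prop)]
  rw [h1, integral_prod _ Integrable.of_finite, ← integral_map hX.aemeasurable (by fun_prop)]
  refine integral_mono Integrable.of_finite Integrable.of_finite fun a => ?_
  refine le_trans (le_of_eq ?_) (hg a)
  exact integral_map hY.aemeasurable (by fun_prop)

theorem integrable_comp_of_finite {Ω A : Type*} [MeasurableSpace Ω] {P : Measure Ω}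
    [IsFiniteMeasure P] [Finite A] [MeasurableSpace A] [MeasurableSingletonClass A] {X : Ω → A}
    (hX : Measurable X) (g : A → ℝ) : Integrable (fun ω => g (X ω)) P :=
  (Integrable.of_finite (μ := P.map X)).comp_measurable hX

variable {n m d : ℕ} {Ω : Type*} [MeasurableSpace Ω] {P : Measure Ω}
  {p : ℝ} {ξ : ℕ → Ω → Bool} {s : ℕ → Fin n → Ω → Fin m}

theorem IsSampling.measurable_round (h : IsSampling P p ξ s) (k : ℕ) :
    Measurable fun ω => (ξ k ω, fun i => s k i ω) :=
  (h.measurable_coin k).prodMk (measurable_pi_lambda _ (h.measurable_sample k))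

variable [IsProbabilityMeasure P]

theorem IsSampling.measureReal_round (h : IsSampling P p ξ s) (k : ℕ) (i : Fin n)
    (r : Bool × Fin m) :
    (P.map fun ω => (ξ k ω, s k i ω)).real {r} = roundWeight p r := by
  obtain ⟨c, j⟩ := r
  have hind : IndepFun (ξ k) (s k i) P :=
    (h.indep_coin k).comp measurable_id (measurable_pi_apply i)
  have hcoin : P.real (ξ k ⁻¹' {c}) = if c then p else 1 - p := by
    have htrue : P.real (ξ k ⁻¹' {true}) = p := h.coin_law k
    cases c
    · have : ξ k ⁻¹' {false} = (ξ k ⁻¹' {true})ᶜ := by ext; simp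
      rw [this, probReal_compl_eq_one_sub (h.measurable_coin k (measurableSet_singleton _)), htrue]
      simp
    · simpa using htrue
  have hsample : P.real (s k i ⁻¹' {j}) = (m : ℝ)⁻¹ := h.sample_law k i j
  rw [map_measureReal_apply ((h.measurable_coin k).prodMk (h.measurable_sample k i))
      (measurableSet_singleton _), Measure.real,
    show (fun ω => (ξ k ω, s k i ω)) ⁻¹' {(c, j)} = ξ k ⁻¹' {c} ∩ s k i ⁻¹' {j} by
      ext; simp,
    hind.measure_inter_preimage_eq_mul _ _ (measurableSet_singleton _) (measurableSet_singleton _),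
    ENNReal.toReal_mul, roundWeight, ← hcoin, ← hsample]
  rfl

theorem IsSampling.integral_round (h : IsSampling P p ξ s) (k : ℕ) (i : Fin n)
    (g : Bool × Fin m → ℝ) :
    ∫ ω, g (ξ k ω, s k i ω) ∂P = ∑ r, roundWeight p r * g r := by
  have hmeas := (h.measurable_coin k).prodMk (h.measurable_sample k i)
  have := Measure.isProbabilityMeasure_map (μ := P) hmeas.aemeasurable
  rw [← integral_map (f := g) hmeas.aemeasurable (by fun_prop),
    integral_fintype Integrable.of_finite]
  exact Finset.sum_congr rfl fun r _ => by rw [h.measureReal_round, smul_eq_mul]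

theorem IsSampling.integral_lyapunov_step (h : IsSampling P p ξ s)
    (f : Fin n → Fin m → Model d → ℝ) (lam α L : ℝ) (xs : Models n d) (S : State n m d) (k : ℕ) :
    ∫ ω, lyapunov f lam p α L xs (step f lam p α (ξ k ω) (fun i => s k i ω) S) ∂P
      = ∑ i, ∑ r : Bool × Fin m, roundWeight p r *
          deviceLyapunov f lam p α L xs (step f lam p α r.1 (fun _ => r.2) S) i := by
  simp only [lyapunov_eq_sum]
  simp only [deviceLyapunov_step xs S (ξ k _)]
  rw [integral_finsetSum]
  · exact Finset.sum_congr rfl fun i _ => h.integral_round k i fun r =>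
      deviceLyapunov f lam p α L xs (step f lam p α r.1 (fun _ => r.2) S) i
  · exact fun i _ => integrable_comp_of_finite
      ((h.measurable_coin k).prodMk (h.measurable_sample k i)) fun r =>
        deviceLyapunov f lam p α L xs (step f lam p α r.1 (fun _ => r.2) S) i

/-- The state of the method after the rounds `0, …, k - 1` with the given outcomes. Later rounds
are filled in with `r0`; they do not matter. -/
noncomputable def runOfHistory (f : Fin n → Fin m → Model d → ℝ) (lam p α : ℝ) (x0 : Model d)
    (r0 : Bool × (Fin n → Fin m)) (k : ℕ)
    (a : ↥(Finset.range k) → Bool × (Fin n → Fin m)) : State n m d :=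
  run f lam p α x0 (fun t => if h : t ∈ Finset.range k then (a ⟨t, h⟩).1 else r0.1)
    (fun t => if h : t ∈ Finset.range k then (a ⟨t, h⟩).2 else r0.2) k

theorem run_eq_runOfHistory (f : Fin n → Fin m → Model d → ℝ) (lam p α : ℝ) (x0 : Model d)
    (r0 : Bool × (Fin n → Fin m)) (k : ℕ) (coin : ℕ → Bool) (σ : ℕ → Fin n → Fin m) :
    run f lam p α x0 coin σ k
      = runOfHistory f lam p α x0 r0 k fun t => (coin t, σ t) := by
  refine run_congr lam p α x0 (fun t ht => ?_) fun t ht => ?_ <;>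
  rw [dif_pos (Finset.mem_range.2 ht)]

/-- A function of the state takes finitely many values. -/
theorem IsSampling.integrable_run (h : IsSampling P p ξ s) (hm : 0 < m)
    (f : Fin n → Fin m → Model d → ℝ) (lam α : ℝ) (x0 : Model d) (k : ℕ)
    (φ : State n m d → ℝ) :
    Integrable (fun ω => φ (run f lam p α x0 (fun t => ξ t ω) (fun t i => s t i ω) k)) P := by
  simp only [run_eq_runOfHistory f lam p α x0 (true, fun _ => ⟨0, hm⟩) k]
  exact integrable_comp_of_finite
    (X := fun ω (t : ↥(Finset.range k)) => (ξ t ω, fun i => s t i ω))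
    (measurable_pi_lambda _ fun t => h.measurable_round t) fun a => φ (runOfHistory _ _ _ _ _ _ _ a)

/-- The round `k` is independent of the state before it, so that a one-round bound valid for every
reachable state can be integrated. -/
theorem IsSampling.integral_run_succ_le (h : IsSampling P p ξ s) (hm : 0 < m)
    (f : Fin n → Fin m → Model d → ℝ) (lam α : ℝ) (x0 : Model d) (k : ℕ)
    {φ ψ : State n m d → ℝ}
    (hφ : ∀ coin σ, ∫ ω, φ (step f lam p α (ξ k ω) (fun i => s k i ω)
      (run f lam p α x0 coin σ k)) ∂P ≤ ψ (run f lam p α x0 coin σ k)) :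
    ∫ ω, φ (run f lam p α x0 (fun t => ξ t ω) (fun t i => s t i ω) (k + 1)) ∂P
      ≤ ∫ ω, ψ (run f lam p α x0 (fun t => ξ t ω) (fun t i => s t i ω) k) ∂P := by
  set r0 : Bool × (Fin n → Fin m) := (true, fun _ => ⟨0, hm⟩)
  have hind := (h.indep_rounds.indepFun_finset (Finset.range k) {k} (by simp)
    h.measurable_round).comp measurable_id
    (measurable_pi_apply (⟨k, Finset.mem_singleton_self k⟩ : ({k} : Finset ℕ)))
  simp only [run, run_eq_runOfHistory f lam p α x0 r0 k]
  exact integral_comp_le_of_indepFun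
    (X := fun ω (t : ↥(Finset.range k)) => (ξ t ω, fun i => s t i ω))
    (Y := fun ω => (ξ k ω, fun i => s k i ω))
    (measurable_pi_lambda _ fun t => h.measurable_round t) (h.measurable_round k) hind
    (g := fun a r => φ (step f lam p α r.1 r.2 (runOfHistory f lam p α x0 r0 k a)))
    (c := fun a => ψ (runOfHistory f lam p α x0 r0 k a)) fun a => hφ _ _

end Randomness

end L2SGDPlus

/-! ### Convergence -/

theorem mainTheorem6 {n m d : ℕ} (hn : 0 < n) (hm : 0 < m)
    (f : Fin n → Fin m → L2SGDPlus.Model d → ℝ) (L μ lam p α : ℝ)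
    (hL : 0 < L) (hμ : 0 < μ) (hlam : 0 ≤ lam) (hp0 : 0 < p) (hp1 : p < 1)
    (hconv : ∀ i j, ConvexOn ℝ Set.univ (f i j))
    (hsmooth : ∀ i j, L2SGDPlus.IsSmooth L (f i j))
    (hstrong : ∀ i, StrongConvexOn Set.univ μ (L2SGDPlus.localObjective f i))
    (hα : α = n * min ((1 - p) / (4 * L + μ * m)) (p / (4 * lam + μ))) :
    -- the objective has a unique minimizer `xs`
    ∃ xs : L2SGDPlus.Models n d,
      (∀ y, L2SGDPlus.objective f lam xs ≤ L2SGDPlus.objective f lam y) ∧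
      (∀ z, (∀ y, L2SGDPlus.objective f lam z ≤ L2SGDPlus.objective f lam y) → z = xs) ∧
      -- the contraction factor lies strictly between `0` and `1`
      0 < 1 - α * μ / n ∧ 1 - α * μ / n < 1 ∧
      -- for every starting point and every realization of the randomness
      ∀ (x0 : L2SGDPlus.Model d) {Ω : Type*} [MeasurableSpace Ω] (P : Measure Ω)
        [IsProbabilityMeasure P] (ξ : ℕ → Ω → Bool) (s : ℕ → Fin n → Ω → Fin m),
        L2SGDPlus.IsSampling P p ξ s →
        -- linear convergence
        (∀ k : ℕ,
          Integrable (fun ω => L2SGDPlus.lyapunov f lam p α L xs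
            (L2SGDPlus.run f lam p α x0 (fun t => ξ t ω) (fun t i => s t i ω) k)) P ∧
          ∫ ω, L2SGDPlus.lyapunov f lam p α L xs
              (L2SGDPlus.run f lam p α x0 (fun t => ξ t ω) (fun t i => s t i ω) k) ∂P
            ≤ (1 - α * μ / n) ^ k * L2SGDPlus.lyapunov f lam p α L xs
                (L2SGDPlus.initState x0)) ∧
        -- iteration complexity
        (∀ ε : ℝ, 0 < ε → ∀ k : ℕ,
          max ((4 * L + μ * m) / ((1 - p) * μ)) ((4 * lam + μ) / (p * μ)) * Real.log (1 / ε)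
              ≤ k →
          ∫ ω, L2SGDPlus.lyapunov f lam p α L xs
              (L2SGDPlus.run f lam p α x0 (fun t => ξ t ω) (fun t i => s t i ω) k) ∂P
            ≤ ε * L2SGDPlus.lyapunov f lam p α L xs (L2SGDPlus.initState x0) ∧
          Integrable (fun ω => L2SGDPlus.sqDist
            (L2SGDPlus.run f lam p α x0 (fun t => ξ t ω) (fun t i => s t i ω) k).x xs) P ∧
          ∫ ω, L2SGDPlus.sqDist
              (L2SGDPlus.run f lam p α x0 (fun t => ξ t ω) (fun t i => s t i ω) k).x xs ∂P
            ≤ ε * L2SGDPlus.lyapunov f lam p α L xs (L2SGDPlus.initState x0)) := by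
  obtain ⟨β, hβdef⟩ : ∃ β, β = min ((1 - p) / (4 * L + μ * m)) (p / (4 * lam + μ)) := ⟨_, rfl⟩
  rw [← hβdef] at hα
  subst hα
  have hn' : (0 : ℝ) < n := by positivity
  have hq : 0 < 1 - p := by linarith
  have hu : 0 < 4 * L + μ * m := by positivity
  have hv : 0 < 4 * lam + μ := by positivity
  have hβ : 0 < β := by rw [hβdef]; exact lt_min (by positivity) (by positivity)
  have hβ1 : β * (4 * L + μ * m) ≤ 1 - p := by
    rw [← le_div_iff₀ hu, hβdef]; exact min_le_left _ _
  have hβ2 : β * (4 * lam + μ) ≤ p := by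
    rw [← le_div_iff₀ hv, hβdef]; exact min_le_right _ _
  have hrate : n * β * μ / n = β * μ := by field_simp
  have hf : ∀ i j, Differentiable ℝ (f i j) := fun i j => (hsmooth i j).1
  have hβμ : 0 < β * μ := mul_pos hβ hμ
  have hρ0 : 0 < 1 - β * μ := by nlinarith [mul_nonneg hβ.le hlam]
  have hα0 : 0 ≤ n * β := by positivity
  rw [hrate]
  obtain ⟨xs, hxs⟩ := (L2SGDPlus.continuous_objective (lam := lam) hf).exists_forall_le
    (L2SGDPlus.tendsto_objective_cocompact hn hμ hlam hf hstrong)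
  have hopt := L2SGDPlus.optimality_of_forall_le hn hf hxs
  refine ⟨xs, hxs, fun z hz => L2SGDPlus.eq_of_optimality hn hμ hlam hf hstrong
    (L2SGDPlus.optimality_of_forall_le hn hf hz) hopt, hρ0, by linarith, ?_⟩
  intro x0 Ω _ P _ ξ s hs
  have hlin : ∀ k : ℕ, ∫ ω, L2SGDPlus.lyapunov f lam p (n * β) L xs
      (L2SGDPlus.run f lam p (n * β) x0 (fun t => ξ t ω) (fun t i => s t i ω) k) ∂P
      ≤ (1 - β * μ) ^ k * L2SGDPlus.lyapunov f lam p (n * β) L xs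
          (L2SGDPlus.initState x0) := by
    intro k
    induction k with
    | zero => simp [L2SGDPlus.run]
    | succ k ih =>
      refine (hs.integral_run_succ_le hm f lam (n * β) x0 k
        (ψ := fun S => (1 - β * μ) * L2SGDPlus.lyapunov f lam p (n * β) L xs S)
        fun coin σ => ?_).trans ?_
      · rw [hs.integral_lyapunov_step]
        exact L2SGDPlus.sum_weight_lyapunov_step_le hn hm hL hlam hp0 hp1 hconv hsmooth hstrong
          hβ hβ1 hβ2 hμ hopt fun h0 => L2SGDPlus.run_Psi_eq_zero h0 _ _ _ _ _ _
      · rw [integral_const_mul, pow_succ', mul_assoc]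
        exact mul_le_mul_of_nonneg_left ih hρ0.le
  refine ⟨fun k => ⟨hs.integrable_run hm f lam (n * β) x0 k _, hlin k⟩, fun ε hε k hk => ?_⟩
  have hle := L2SGDPlus.sqDist_le_lyapunov (f := f) hα0 hL.le hlam hp0.le hp1.le xs
  have hpow : (1 - β * μ) ^ k ≤ ε := by
    -- the threshold is `log (1 / ε)` divided by `β * μ`
    have hmax : max ((4 * L + μ * m) / ((1 - p) * μ)) ((4 * lam + μ) / (p * μ)) * (β * μ) = 1 := by
      rw [max_mul_of_nonneg _ _ hβμ.le]
      have h1 : (4 * L + μ * m) / ((1 - p) * μ) * (β * μ)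
          = β / ((1 - p) / (4 * L + μ * m)) := by field_simp
      have h2 : (4 * lam + μ) / (p * μ) * (β * μ) = β / (p / (4 * lam + μ)) := by field_simp
      rw [h1, h2]
      have ha : 0 < (1 - p) / (4 * L + μ * m) := by positivity
      have hb : 0 < p / (4 * lam + μ) := by positivity
      refine le_antisymm (max_le ?_ ?_) ?_
      · rw [div_le_one ha, hβdef]; exact min_le_left _ _
      · rw [div_le_one hb, hβdef]; exact min_le_right _ _
      · rcases min_choice ((1 - p) / (4 * L + μ * m)) (p / (4 * lam + μ)) with h | h
        · refine le_max_of_le_left ?_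
          rw [hβdef, h, div_self ha.ne']
        · refine le_max_of_le_right ?_
          rw [hβdef, h, div_self hb.ne']
    have hk' := mul_le_mul_of_nonneg_right hk hβμ.le
    rw [mul_right_comm, hmax, one_mul, one_div, Real.log_inv] at hk'
    calc (1 - β * μ) ^ k ≤ Real.exp (-(β * μ)) ^ k := by
          gcongr
          exact Real.one_sub_le_exp_neg _
      _ = Real.exp (-(k * (β * μ))) := by rw [← Real.exp_nat_mul]; ring_nf
      _ ≤ Real.exp (Real.log ε) := Real.exp_le_exp.2 (by linarith)
      _ = ε := Real.exp_log hε
  have hV := (hlin k).trans (mul_le_mul_of_nonneg_right hpow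
    ((L2SGDPlus.sqDist_nonneg _ _).trans (hle (L2SGDPlus.initState x0))))
  have hint := hs.integrable_run hm f lam (n * β) x0 k fun S => L2SGDPlus.sqDist S.x xs
  exact ⟨hV, hint, (integral_mono hint (hs.integrable_run hm f lam (n * β) x0 k _)
    fun ω => hle _).trans hV⟩
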